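/- Identify samples with finite sequences $S=((x_1,y_1),\dots,(x_m,y_m))$ in $\mathbb N\times\{0,1\}$. A hypothesis is a function $h:\mathbb N\to\{0,1\}$, with support $h^{-1}(1)$; a hypothesis class is a set $\mathcal H\subseteq\{0,1\}^{\mathbb N}$; a learner is a map $A$ from samples to hypotheses. For a probability distribution $D$ on $\mathbb N\times\{0,1\}$ put $L_D(h)=\Pr_{(x,y)\sim D}[h(x)\neq y]$. For $n\ge 1$ and $m\ge 0$, say that $A$ succeeds at $(n,m)$ for $\mathcal H$ if for every probability distribution $D$ on $\mathbb N\times\{0,1\}$, $$\Pr_{S\sim D^m}\Big[L_D(A(S))\le \inf_{h\in\mathcal H}L_D(h)+\tfrac1n\Big]\ge 1-\tfrac1n .$$ The learner $A$ PAC learns $\mathcal H$ if for every $n\ge1$ there is $k$ such that $A$ succeeds at $(n,m)$ for all $m\ge k$; the least such $k$ is denoted $m_A(n)$, and the function $n\mapsto m_A(n)$ is the sample complexity of $A$ with respect to $\mathcal H$. The learner $A$ is proper for $\mathcal H$ if $A(S)\in\mathcal H$ for every sample $S$, and computable if some algorithm transforms each sample $S$ into a program computing the total function $A(S)$. The class $\mathcal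 H$ is properly CPAC learnable if some computable learner that is proper for $\mathcal H$ PAC learns $\mathcal H$; it is properly SCPAC learnable if, in addition, such a learner can be chosen with $m_A(n)\le g(n)$ for all $n\ge1$, for some total computable $g:\mathbb N\to\mathbb N$. The class $\mathcal H$ is decidable if some algorithm, given as a finite list the support of a finitely supported function $h:\mathbb N\to\{0,1\}$, decides whether $h\in\mathcal H$. **Theorem.** There is a decidable hypothesis class $\mathcal H$, all of whose members have finite support, that is properly CPAC learnable but not properly SCPAC learnable. Thus no computable learner that is proper for $\mathcal H$ and PAC learns $\mathcal H$ has sample complexity bounded from above by a total computable function. -/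

import Mathlib

open MeasureTheory
open scoped ENNReal

namespace CPAC

/-- A hypothesis is a `{0,1}`-valued function on `ℕ` (`true` is `1`). -/
abbrev Hypothesis : Type := ℕ → Bool

/-- A sample of size `m` is a list of length `m` of labelled points. -/
abbrev Sample : Type := List (ℕ × Bool)

/-- A learner is an arbitrary map from samples (of all sizes) to hypotheses. -/
abbrev Learner : Type := Sample → Hypothesis

/-- The generalization error `Pr_{(x, y) ∼ D} [h x ≠ y]`. -/
noncomputable def genError (D : Measure (ℕ × Bool)) (h : Hypothesis) : ℝ≥0∞ :=
  D {p | h p.1 ≠ p.2}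

/-- For every distribution `D`, with probability at least `1 - 1/n` over `m` independent draws
from `D`, the output of `A` has error at most `inf_{h ∈ H} L_D(h) + 1/n`. -/
def Succeeds (H : Set Hypothesis) (A : Learner) (n m : ℕ) : Prop :=
  ∀ D : Measure (ℕ × Bool), IsProbabilityMeasure D →
    1 - 1 / (n : ℝ≥0∞) ≤
      Measure.pi (fun _ : Fin m => D)
        {S : Fin m → ℕ × Bool |
          genError D (A (List.ofFn S)) ≤ (⨅ h ∈ H, genError D h) + 1 / (n : ℝ≥0∞)}

/-- `A` PAC learns `H` (in the agnostic sense). -/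
def PACLearns (A : Learner) (H : Set Hypothesis) : Prop :=
  ∀ n : ℕ, 1 ≤ n → ∃ k : ℕ, ∀ m : ℕ, k ≤ m → Succeeds H A n m

/-- The sample complexity of `A` with respect to `H` at `n`: the least `k` such that `A` succeeds
on all sample sizes `m ≥ k`. Meaningful when `A` PAC learns `H` and `1 ≤ n`. -/
noncomputable def sampleComplexity (H : Set Hypothesis) (A : Learner) (n : ℕ) : ℕ :=
  sInf {k : ℕ | ∀ m : ℕ, k ≤ m → Succeeds H A n m}

/-- The sample complexity is bounded from above by some total computable function. -/
def HasComputablyBoundedSampleComplexity (H : Set Hypothesis) (A : Learner) : Prop :=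
  ∃ g : ℕ → ℕ, Computable g ∧ ∀ n : ℕ, 1 ≤ n → sampleComplexity H A n ≤ g n

/-- `A` is proper for `H`: it only outputs hypotheses from `H`. -/
def IsProper (A : Learner) (H : Set Hypothesis) : Prop :=
  ∀ S : Sample, A S ∈ H

/-- `A` is computable: some algorithm transforms every sample `S` into a program that
computes the function `A S` on every input. -/
def IsComputable (A : Learner) : Prop :=
  ∃ c : Sample → Nat.Partrec.Code, Computable c ∧
    ∀ (S : Sample) (x : ℕ), (c S).eval x = Part.some (A S x).toNat

def ProperlyCPACLearnable (H : Set Hypothesis) : Prop :=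
  ∃ A : Learner, IsComputable A ∧ PACLearns A H ∧ IsProper A H

def ProperlySCPACLearnable (H : Set Hypothesis) : Prop :=
  ∃ A : Learner, IsComputable A ∧ PACLearns A H ∧ IsProper A H ∧
    HasComputablyBoundedSampleComplexity H A

/-- Every hypothesis in `H` has finite support. -/
def FinitelySupported (H : Set Hypothesis) : Prop :=
  ∀ h ∈ H, {x : ℕ | h x = true}.Finite

/-- `H` is decidable: an algorithm that is given the support of a finitely supported function,
as a finite list of its elements, decides whether the function belongs to `H`. -/
def IsDecidableClass (H : Set Hypothesis) : Prop :=
  ComputablePred fun l : List ℕ => (fun x : ℕ => decide (x ∈ l)) ∈ H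

end CPAC

namespace CPAC

open ProbabilityTheory
open Nat.Partrec (Code)

/-! Column `i` carries a block of `i + 2` points. The class contains every block with one point
removed, and, if program `i` halts, the block together with one point `Nat.pair i t` outside it that
records a halting time. A bounded run checks such a witness, so the class is decidable; whether some
member contains the whole block is the halting problem.

Positive part: `boxLearner` minimizes empirical error over the indices in a box that grows with the
sample. Indices outside the box are no threat (`exists_forall_errCount_bestIndex_le`): in a column
`i ≥ n`, removing the rarest block point costs at most a fraction `1 / n` of the sample, and the
finitely many columns below `n` show a halting witness inside the box once the sample is long. This
length is the only noncomputable ingredient. Uniform convergence over the class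
(`mul_measure_exists_le_deviation_le`, `loss_eq`) turns empirical error into true error.

Negative part: if program `i` halts, a learner with accuracy `1 / (i + 3)` must output a superset of
the block on some sample from the uniform distribution on it (`Succeeds.exists_sample`). A proper
learner can do so only if program `i` halts (`haltsBy_of_forall_hyp`). A computable bound on the
sample size makes the search over samples finite, which would decide halting. -/

/-- The program number `i` halts on input `0` within `t` steps. -/
def HaltsBy (i t : ℕ) : Prop := (Code.evaln t (Denumerable.ofNat Code i) 0).isSome = true

/-- The block of column `i` consists of the points `Nat.pair i j` with `j < i + 2`. -/
def InBlock (y : ℕ) : Prop := y.unpair.2 < y.unpair.1 + 2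

/-- The points that index the hypotheses of the class: the block points, and the points
`Nat.pair i t` that witness that the program number `i` halts. -/
def Valid (x : ℕ) : Prop := InBlock x ∨ HaltsBy x.unpair.1 x.unpair.2

instance : DecidableRel HaltsBy := fun _ _ => inferInstanceAs (Decidable (_ = _))
instance : DecidablePred InBlock := fun _ => inferInstanceAs (Decidable (_ < _))
instance : DecidablePred Valid := fun _ => inferInstanceAs (Decidable (_ ∨ _))

/-- The indicator function of the symmetric difference of `{x}` and the block in the column
of `x`. -/
def hyp (x : ℕ) : Hypothesis :=
  fun y => xor (decide (y.unpair.1 = x.unpair.1 ∧ InBlock y)) (decide (y = x))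

/-- The hypothesis class that encodes the halting problem. -/
def haltingClass : Set Hypothesis := {h | ∃ x, Valid x ∧ hyp x = h}

/-- Every pair with entries at most `N + 2` has a code below `box N`. -/
def box (N : ℕ) : ℕ := Nat.pair (N + 2) (N + 2) + 1

/-- A number at least the length of the sample and above all of its points. -/
def sampleBound (S : Sample) : ℕ := S.foldr (fun p n => p.1 + 1 + n) 0

/-- The number of errors of `hyp x` on the sample. -/
def errCount (S : Sample) (x : ℕ) : ℕ := S.countP fun p => hyp x p.1 != p.2

/-- A minimizer of `errCount S` among the valid points below `k`, by linear search. -/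
def bestBelow (S : Sample) (k : ℕ) : ℕ :=
  k.rec 0 fun k b => if Valid k ∧ errCount S k < errCount S b then k else b

/-- Empirical risk minimization over the valid points below a bound that depends on the sample. -/
def bestIndex (S : Sample) : ℕ := bestBelow S (box (sampleBound S))

/-- The learner that outputs the hypothesis with index `bestIndex S`. -/
def boxLearner : Learner := fun S => hyp (bestIndex S)

/-! ### Primitive recursiveness of the class and of the learner. -/

section Computability

open Primrec

lemma primrec_col : Primrec fun x : ℕ => x.unpair.1 := fst.comp unpair

lemma primrec_row : Primrec fun x : ℕ => x.unpair.2 := snd.comp unpair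

lemma primrecPred_inBlock : PrimrecPred InBlock :=
  nat_lt.comp primrec_row (nat_add.comp primrec_col (const 2))

lemma primrecPred_valid : PrimrecPred Valid := by
  refine primrecPred_inBlock.or ?_
  refine Primrec.eq.comp (option_isSome.comp (Code.primrec_evaln.comp
    (Primrec.pair (Primrec.pair primrec_row ((Primrec.ofNat Code).comp primrec_col)) (const 0))))
    (const true)

lemma primrec₂_hyp : Primrec₂ hyp := by
  refine (dom_bool₂ xor).comp ?_ ?_
  · exact ((Primrec.eq.comp (primrec_col.comp snd) (primrec_col.comp fst)).and
      (primrecPred_inBlock.comp snd)).decide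
  · exact (Primrec.eq.comp snd fst).decide

lemma primrec_box : Primrec box :=
  have h : Primrec fun N : ℕ => N + 2 := nat_add.comp Primrec.id (const 2)
  succ.comp (Primrec₂.natPair.comp h h)

lemma primrec_sampleBound : Primrec sampleBound := by
  refine list_foldr (f := fun S : Sample => S) (h := fun _ q => q.1.1 + 1 + q.2)
    Primrec.id (const 0) ?_
  exact nat_add.comp (succ.comp (fst.comp (fst.comp snd))) (snd.comp snd)

lemma primrec₂_errCount : Primrec₂ errCount := by
  have h : PrimrecRel fun (p : ℕ × Bool) (x : ℕ) => hyp x p.1 ≠ p.2 :=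
    (Primrec.eq.comp (primrec₂_hyp.comp snd (fst.comp fst)) (snd.comp fst)).not
  refine ((list_length (α := ℕ × Bool)).comp h.listFilter).of_eq fun q => ?_
  rw [errCount, List.countP_eq_length_filter]
  refine congrArg List.length (congrArg (List.filter · q.1) (funext fun p => ?_))
  rw [decide_not, bne, beq_eq_decide]

lemma primrec_bestIndex : Primrec bestIndex := by
  have hE : Primrec₂ fun (S : Sample) (q : ℕ × ℕ) =>
      if Valid q.1 ∧ errCount S q.1 < errCount S q.2 then q.1 else q.2 := by
    refine Primrec.ite ?_ (fst.comp snd) (snd.comp snd)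
    exact (primrecPred_valid.comp (fst.comp snd)).and
      (nat_lt.comp (primrec₂_errCount.comp fst (fst.comp snd))
        (primrec₂_errCount.comp fst (snd.comp snd)))
  exact (nat_rec (const 0) hE).comp Primrec.id (primrec_box.comp primrec_sampleBound)

lemma isComputable_boxLearner : IsComputable boxLearner := by
  have hf : Primrec fun q : ℕ => (hyp q.unpair.1 q.unpair.2).toNat :=
    (dom_bool Bool.toNat).comp (primrec₂_hyp.comp primrec_col primrec_row)
  obtain ⟨c, hc⟩ := Code.exists_code.1 (Partrec.nat_iff.1 hf.to_comp)
  refine ⟨fun S => Code.curry c (bestIndex S),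
    (Code.primrec₂_curry.comp (const c) primrec_bestIndex).to_comp, fun S x => ?_⟩
  rw [Code.eval_curry, hc]
  simp [boxLearner]

end Computability

/-! ### Supports of the hypotheses, and decidability of the class. -/

lemma lt_box {N i j : ℕ} (hi : i ≤ N + 2) (hj : j ≤ N + 2) : Nat.pair i j < box N :=
  Nat.lt_succ_of_le <|
    ((StrictMono.monotone fun _ _ h => Nat.pair_lt_pair_left j h) hi).trans
      ((StrictMono.monotone fun _ _ h => Nat.pair_lt_pair_right (N + 2) h) hj)

lemma lt_sampleBound {S : Sample} {p : ℕ × Bool} (hp : p ∈ S) : p.1 < sampleBound S := by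
  induction S with
  | nil => simp at hp
  | cons q S ih =>
    simp only [sampleBound, List.foldr_cons, List.mem_cons] at hp ih ⊢
    rcases hp with rfl | hp
    · omega
    · have := ih hp
      omega

lemma length_le_sampleBound (S : Sample) : S.length ≤ sampleBound S := by
  induction S with
  | nil => simp
  | cons q S ih =>
    simp only [sampleBound, List.foldr_cons, List.length_cons] at ih ⊢
    omega

lemma hyp_eq_true_iff {x y : ℕ} :
    hyp x y = true ↔ ¬ ((y.unpair.1 = x.unpair.1 ∧ InBlock y) ↔ y = x) := by
  by_cases h₁ : y.unpair.1 = x.unpair.1 ∧ InBlock y <;> by_cases h₂ : y = x <;> simp [hyp, h₁, h₂]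

lemma col_eq_of_hyp {x y : ℕ} (h : hyp x y = true) : y.unpair.1 = x.unpair.1 := by
  rw [hyp_eq_true_iff] at h
  by_contra hne
  refine h ⟨fun hh => absurd hh.1 hne, ?_⟩
  rintro rfl
  exact absurd rfl hne

lemma lt_box_of_hyp {x y : ℕ} (h : hyp x y = true) : y < box x := by
  have hcol := col_eq_of_hyp h
  have h1 := Nat.unpair_left_le x
  have h2 := Nat.unpair_right_le x
  have hb : InBlock y ∨ y = x := by
    rw [hyp_eq_true_iff] at h
    tauto
  rw [← Nat.pair_unpair y]
  rcases hb with hb | rfl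
  · unfold InBlock at hb
    exact lt_box (by omega) (by omega)
  · exact lt_box (by omega) (by omega)

/-- A block has at least two points, so one survives a removal. Hence the support always reveals the
column. -/
lemma exists_hyp_eq_true (x : ℕ) : ∃ y, hyp x y = true := by
  by_cases h : x = Nat.pair x.unpair.1 0
  · refine ⟨Nat.pair x.unpair.1 1, ?_⟩
    rw [hyp_eq_true_iff]
    intro hh
    have h3 := (hh.1 ⟨by simp, by simp [InBlock]⟩).trans h
    simp at h3
  · refine ⟨Nat.pair x.unpair.1 0, ?_⟩
    rw [hyp_eq_true_iff]
    intro hh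
    exact h (hh.1 ⟨by simp, by simp [InBlock]⟩).symm

lemma finitelySupported_haltingClass : FinitelySupported haltingClass := by
  rintro _ ⟨x, -, rfl⟩
  exact (Set.finite_lt_nat (box x)).subset fun y hy => lt_box_of_hyp hy

/-- The search for an index is bounded: any point of `l` determines the column, and an index outside
its block is itself in `l`. Equality of functions is a finite check because `hyp x` vanishes from
`box x` on. -/
lemma mem_haltingClass_iff (l : List ℕ) :
    (fun x : ℕ => decide (x ∈ l)) ∈ haltingClass ↔
      ∃ x < box (sampleBound (l.map fun y => (y, true))),
        Valid x ∧ (∀ y ∈ l, hyp x y = true) ∧ ∀ y < box x, hyp x y = true → y ∈ l := by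
  have hN : ∀ y ∈ l, y < sampleBound (l.map fun y => (y, true)) := fun y hy =>
    lt_sampleBound (p := (y, true)) (List.mem_map.2 ⟨y, hy, rfl⟩)
  constructor
  · rintro ⟨x, hx, h⟩
    have hl : ∀ y, hyp x y = true ↔ y ∈ l := fun y => by simp [h]
    refine ⟨x, ?_, hx, fun y hy => (hl y).2 hy, fun y _ hy => (hl y).1 hy⟩
    obtain ⟨y, hy⟩ := exists_hyp_eq_true x
    have h1 := hN y ((hl y).1 hy)
    have h2 := col_eq_of_hyp hy
    have h3 := Nat.unpair_left_le y
    rw [← Nat.pair_unpair x]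
    by_cases hb : InBlock x
    · unfold InBlock at hb
      exact lt_box (by omega) (by omega)
    · have h4 := hN x ((hl x).1 (hyp_eq_true_iff.2 (by tauto)))
      have h5 := Nat.unpair_right_le x
      exact lt_box (by omega) (by omega)
  · rintro ⟨x, -, hx, h1, h2⟩
    refine ⟨x, hx, funext fun y => ?_⟩
    rw [Bool.eq_iff_iff, decide_eq_true_iff]
    exact ⟨fun hy => h2 y (lt_box_of_hyp hy) hy, h1 y⟩

lemma isDecidableClass_haltingClass : IsDecidableClass haltingClass := by
  have hmem : PrimrecRel fun (l : List ℕ) (y : ℕ) => y ∈ l :=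
    (PrimrecRel.exists_mem_list (R := fun a b : ℕ => a = b) Primrec.eq).of_eq (by simp)
  have h1 : PrimrecRel fun (l : List ℕ) (x : ℕ) => ∀ y ∈ l, hyp x y = true := by
    refine PrimrecRel.forall_mem_list (R := fun y x : ℕ => hyp x y = true) ?_
    exact Primrec.eq.comp (primrec₂_hyp.comp .snd .fst) (.const true)
  have h2 : PrimrecRel fun (l : List ℕ) (x : ℕ) => ∀ y < box x, hyp x y = true → y ∈ l := by
    have h3 : PrimrecRel fun (y : ℕ) (q : List ℕ × ℕ) => hyp q.2 y = true → y ∈ q.1 := by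
      refine PrimrecPred.of_eq (PrimrecPred.or (PrimrecPred.not (Primrec.eq.comp
        (primrec₂_hyp.comp (Primrec.snd.comp .snd) .fst) (.const true)))
        (hmem.comp (Primrec.fst.comp .snd) .fst)) fun q => ?_
      simp only [imp_iff_not_or]
    exact (h3.forall_mem_list.comp (Primrec.list_range.comp (primrec_box.comp .snd)) .id).of_eq
      (by simp)
  have h3 : PrimrecRel fun (x : ℕ) (l : List ℕ) =>
      Valid x ∧ (∀ y ∈ l, hyp x y = true) ∧ ∀ y < box x, hyp x y = true → y ∈ l :=
    (primrecPred_valid.comp .fst).and ((h1.comp .snd .fst).and (h2.comp .snd .fst))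
  have hb : Primrec fun l : List ℕ => sampleBound (l.map fun y => (y, true)) :=
    primrec_sampleBound.comp (Primrec.list_map .id (Primrec.snd.pair (.const true)))
  have h4 := (h3.exists_mem_list.comp (Primrec.list_range.comp (primrec_box.comp hb)) .id).of_eq
    (q := fun l : List ℕ => (fun x : ℕ => decide (x ∈ l)) ∈ haltingClass)
    fun l => by rw [mem_haltingClass_iff]; simp
  obtain ⟨_, h⟩ := h4
  exact ⟨_, h.to_comp⟩

/-! ### Empirical risk minimization inside the box. -/

lemma valid_bestBelow (S : Sample) (k : ℕ) : Valid (bestBelow S k) := by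
  induction k with
  -- The starting value `0` codes `(0, 0)`, a block point.
  | zero => exact Or.inl (by simp [InBlock, bestBelow])
  | succ k ih =>
    change Valid (if Valid k ∧ errCount S k < errCount S (bestBelow S k) then k else bestBelow S k)
    split_ifs with h
    exacts [h.1, ih]

lemma errCount_bestBelow_le (S : Sample) {k x : ℕ} (hx : Valid x) (hk : x < k) :
    errCount S (bestBelow S k) ≤ errCount S x := by
  induction k with
  | zero => omega
  | succ k ih =>
    change errCount S (if Valid k ∧ errCount S k < errCount S (bestBelow S k) then k
      else bestBelow S k) ≤ _
    rcases Nat.lt_succ_iff_lt_or_eq.1 hk with h | rfl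
    · have := ih h
      split_ifs with h'
      exacts [h'.2.le.trans this, this]
    · split_ifs with h'
      exacts [le_rfl, not_lt.1 fun h => h' ⟨hx, h⟩]

lemma isProper_boxLearner : IsProper boxLearner haltingClass :=
  fun S => ⟨bestIndex S, valid_bestBelow S _, rfl⟩

lemma HaltsBy.mono {i s t : ℕ} (hst : s ≤ t) (h : HaltsBy i s) : HaltsBy i t := by
  obtain ⟨v, hv⟩ := Option.isSome_iff_exists.1 h
  exact Option.isSome_iff_exists.2 ⟨v, Code.evaln_mono hst hv⟩

lemma exists_haltsBy_iff (i : ℕ) :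
    (∃ t, HaltsBy i t) ↔ (Code.eval (Denumerable.ofNat Code i) 0).Dom := by
  constructor
  · rintro ⟨t, h⟩
    obtain ⟨v, hv⟩ := Option.isSome_iff_exists.1 h
    exact Part.dom_iff_mem.2 ⟨v, Code.evaln_sound hv⟩
  · intro h
    obtain ⟨v, hv⟩ := Part.dom_iff_mem.1 h
    obtain ⟨t, ht⟩ := Code.evaln_complete.1 hv
    exact ⟨t, Option.isSome_iff_exists.2 ⟨v, ht⟩⟩

lemma countP_le_countP_add {α : Type*} {p q r : α → Bool} {l : List α}
    (h : ∀ a ∈ l, p a = true → q a = true ∨ r a = true) :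
    l.countP p ≤ l.countP q + l.countP r := by
  induction l with
  | nil => simp
  | cons a l ih =>
    have h1 := ih fun b hb => h b (List.mem_cons_of_mem _ hb)
    have h2 := h a List.mem_cons_self
    simp only [List.countP_cons]
    cases hp : p a <;> cases hq : q a <;> cases hr : r a <;> simp_all <;> omega

/-- Two hypotheses with indices in the same column differ at their indices only. -/
lemma hyp_eq_hyp_of_ne {x x' y : ℕ} (hcol : x.unpair.1 = x'.unpair.1) (h : y ≠ x) (h' : y ≠ x') :
    hyp x y = hyp x' y := by
  simp [hyp, hcol, h, h']

/-- As `x` does not occur in the sample, only occurrences of `x'` can tell the two hypotheses apart.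
-/
lemma errCount_le_add {S : Sample} {x x' : ℕ} (hcol : x.unpair.1 = x'.unpair.1)
    (hx : ∀ p ∈ S, p.1 ≠ x) :
    errCount S x' ≤ errCount S x + S.countP fun p => p.1 == x' := by
  refine countP_le_countP_add fun p hp h => ?_
  by_cases hpx : p.1 = x'
  · exact Or.inr (by simp [hpx])
  · exact Or.inl (by rwa [hyp_eq_hyp_of_ne hcol (hx p hp) hpx])

lemma errCount_congr {S : Sample} {x x' : ℕ} (h : ∀ p ∈ S, hyp x p.1 = hyp x' p.1) :
    errCount S x = errCount S x' :=
  List.countP_congr fun p hp => by rw [h p hp]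

/-- A block has a point that makes up at most its share of the sample. -/
lemma exists_countP_le (S : Sample) (i : ℕ) :
    ∃ j < i + 2, (i + 2) * S.countP (fun p => p.1 == Nat.pair i j) ≤ S.length := by
  have hsum : ∑ j ∈ Finset.range (i + 2), S.countP (fun p => p.1 == Nat.pair i j) ≤ S.length := by
    induction S with
    | nil => simp
    | cons p S ih =>
      simp only [List.countP_cons, List.length_cons, Finset.sum_add_distrib]
      refine add_le_add ih ?_
      rw [← Finset.sum_filter, ← Finset.card_eq_sum_ones, Finset.card_le_one]
      intro a ha b hb
      simp only [Finset.mem_filter, beq_iff_eq] at ha hb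
      exact (Nat.pair_eq_pair.1 (ha.2.symm.trans hb.2)).2
  obtain ⟨j, hj, hmin⟩ := Finset.exists_min_image (Finset.range (i + 2))
    (fun j => S.countP fun p => p.1 == Nat.pair i j) ⟨0, by simp⟩
  refine ⟨j, Finset.mem_range.1 hj, le_trans ?_ hsum⟩
  simpa using Finset.card_nsmul_le_sum _ _ _ hmin

/-- Finitely many programs have a common bound on their halting times; it exists without being
computable from `n`. -/
lemma exists_haltsBy_of_lt (n : ℕ) : ∃ M, ∀ i < n, ∀ t, HaltsBy i t → HaltsBy i M := by
  have h : ∀ i, ∃ M, ∀ t, HaltsBy i t → HaltsBy i M := fun i => by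
    by_cases h : ∃ t, HaltsBy i t
    · exact h.imp fun M hM _ _ => hM
    · exact ⟨0, fun t ht => absurd ⟨t, ht⟩ h⟩
  choose f hf using h
  exact ⟨∑ i ∈ Finset.range n, f i, fun i hi t ht =>
    (hf i t ht).mono (Finset.single_le_sum (fun _ _ => Nat.zero_le _) (Finset.mem_range.2 hi))⟩

/-- On large samples, `boxLearner` approximately minimizes the empirical error. -/
lemma exists_forall_errCount_bestIndex_le (n : ℕ) :
    ∃ M, ∀ S : Sample, M ≤ S.length → ∀ x, Valid x →
      n * errCount S (bestIndex S) ≤ n * errCount S x + S.length := by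
  obtain ⟨M, hM⟩ := exists_haltsBy_of_lt n
  refine ⟨M, fun S hS x hx => ?_⟩
  set N := sampleBound S with hN
  have hpts : ∀ p ∈ S, p.1 < N := fun p hp => lt_sampleBound hp
  have hlen : S.length ≤ N := length_le_sampleBound S
  have hbest : ∀ x', Valid x' → x'.unpair.1 ≤ N + 2 → x'.unpair.2 ≤ N + 2 →
      errCount S (bestIndex S) ≤ errCount S x' := fun x' hx' h1 h2 =>
    errCount_bestBelow_le S hx' (by rw [← Nat.pair_unpair x']; exact lt_box h1 h2)
  have hle : ∀ {a b : ℕ}, a ≤ b → n * a ≤ n * b + S.length := fun h =>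
    (Nat.mul_le_mul_left n h).trans (Nat.le_add_right _ _)
  by_cases hcol : x.unpair.1 ≤ N
  swap
  -- Sample points lie in columns below `N`, so all hypotheses of columns from `N` on vanish on the
  -- sample and make the same errors.
  · have hval : Valid (Nat.pair N 0) := Or.inl (by simp [InBlock])
    refine hle ((hbest _ hval (by simp) (by simp)).trans (errCount_congr fun p hp => ?_).le)
    have h1 := hpts p hp
    have h2 := Nat.unpair_left_le p.1
    have h3 : ∀ {z : ℕ}, N ≤ z.unpair.1 → hyp z p.1 = false := fun hz => by
      rw [← Bool.not_eq_true]
      intro h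
      have := col_eq_of_hyp h
      omega
    rw [h3 (by simp), h3 (by omega)]
  by_cases hrow : x.unpair.2 ≤ N + 2
  · exact hle (hbest x hx (by omega) hrow)
  have hxS : ∀ p ∈ S, p.1 ≠ x := fun p hp h => by
    have h1 := hpts p hp
    have h2 := Nat.unpair_right_le x
    omega
  by_cases hi : x.unpair.1 < n
  -- The program halts within `M ≤ N` steps, so row `N + 2` holds a witness; it avoids the sample
  -- just as `x` does.
  · have hh : HaltsBy x.unpair.1 x.unpair.2 := hx.resolve_left fun hb => by
      unfold InBlock at hb
      omega
    have hval : Valid (Nat.pair x.unpair.1 (N + 2)) :=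
      Or.inr (by simpa using (hM _ hi _ hh).mono (by omega))
    refine hle ((hbest _ hval (by simp; omega) (by simp)).trans (errCount_congr fun p hp => ?_).le)
    refine hyp_eq_hyp_of_ne (by simp) (fun h => ?_) (hxS p hp)
    have h1 := hpts p hp
    have h2 := Nat.right_le_pair x.unpair.1 (N + 2)
    omega
  -- Here nothing need be known about halting: dropping the rarest block point adds at most a share
  -- `1 / (i + 2) ≤ 1 / n` of errors.
  · obtain ⟨j, hj, hcount⟩ := exists_countP_le S x.unpair.1
    have h1 := hbest (Nat.pair x.unpair.1 j) (Or.inl (by simpa [InBlock] using hj))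
      (by simp; omega) (by simp; omega)
    have h2 := errCount_le_add (S := S) (x := x) (x' := Nat.pair x.unpair.1 j) (by simp) hxS
    have h3 := Nat.mul_le_mul_left n (h1.trans h2)
    rw [Nat.mul_add] at h3
    have h4 := (Nat.mul_le_mul_right (S.countP fun p => p.1 == Nat.pair x.unpair.1 j)
      (by omega : n ≤ x.unpair.1 + 2)).trans hcount
    omega

/-! ### Uniform convergence by second moments. -/

/-- The deviation of the sum of `g` over a sample from its expectation. -/
noncomputable def deviation {X : Type*} [MeasurableSpace X] (D : Measure X) {m : ℕ}
    (S : Fin m → X) (g : X → ℝ) : ℝ :=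
  ∑ i, g (S i) - m * ∫ x, g x ∂D

/-- By independence the variance is `m` times that of one indicator, which is at most its second
moment `D E`. This bound can be summed over the cells of a partition. -/
lemma lintegral_deviation_sq_le {X : Type*} [MeasurableSpace X] (D : Measure X)
    [IsProbabilityMeasure D] (m : ℕ) {E : Set X} (hE : MeasurableSet E) :
    ∫⁻ S, ENNReal.ofReal (deviation D S (E.indicator 1) ^ 2) ∂(Measure.pi fun _ : Fin m => D) ≤
      m * D E := by
  set g : X → ℝ := E.indicator 1 with hg
  have hmeas : Measurable g := measurable_one.indicator hE
  have hL2 : MemLp g 2 D := (memLp_const (1 : ℝ)).indicator hE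
  have hL2' : ∀ i : Fin m, MemLp (fun S : Fin m → X => g (S i)) 2 (Measure.pi fun _ => D) :=
    fun i => hL2.comp_measurePreserving (measurePreserving_eval (fun _ : Fin m => D) i)
  set Y : (Fin m → X) → ℝ := ∑ i, fun S => g (S i) with hY
  have hYL2 : MemLp Y 2 (Measure.pi fun _ => D) := memLp_finsetSum' _ fun i _ => hL2' i
  have hmean : ∫ S, Y S ∂(Measure.pi fun _ : Fin m => D) = m * ∫ x, g x ∂D := by
    simp only [hY, Finset.sum_apply]
    rw [integral_finsetSum _ fun i _ => (hL2' i).integrable one_le_two]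
    have : ∀ i : Fin m, ∫ S : Fin m → X, g (S i) ∂(Measure.pi fun _ => D) = ∫ x, g x ∂D := fun i =>
      integral_comp_eval (μ := fun _ : Fin m => D) hmeas.aestronglyMeasurable
    simp [this]
  have hsq : g ^ 2 = g := by
    ext x
    by_cases hx : x ∈ E <;> simp [hg, hx]
  have hvar : Var[Y; Measure.pi fun _ => D] ≤ m * D.real E := by
    rw [hY, variance_sum_pi (X := fun _ : Fin m => g) fun _ => hL2]
    have h := variance_le_expectation_sq (μ := D) hmeas.aestronglyMeasurable
    rw [hsq, hg, integral_indicator_one hE] at h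
    simpa using mul_le_mul_of_nonneg_left h (Nat.cast_nonneg m)
  calc ∫⁻ S, ENNReal.ofReal (deviation D S g ^ 2) ∂(Measure.pi fun _ : Fin m => D)
      = evariance Y (Measure.pi fun _ => D) := by
        rw [evariance_eq_lintegral_ofReal, hmean]
        simp [deviation, hY]
    _ = ENNReal.ofReal (Var[Y; Measure.pi fun _ => D]) := (ofReal_variance hYL2).symm
    _ ≤ ENNReal.ofReal (m * D.real E) := ENNReal.ofReal_le_ofReal hvar
    _ = m * D E := by
        rw [ENNReal.ofReal_mul (Nat.cast_nonneg m), ENNReal.ofReal_natCast, ofReal_measureReal]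

lemma measurable_deviation {X : Type*} [MeasurableSpace X] (D : Measure X) (m : ℕ) {g : X → ℝ}
    (hg : Measurable g) : Measurable fun S : Fin m → X => deviation D S g := by
  unfold deviation
  fun_prop

/-- The frequencies of the cells of a countable partition converge uniformly. -/
lemma mul_measure_exists_le_deviation_le {X : Type*} [MeasurableSpace X] (D : Measure X)
    [IsProbabilityMeasure D] (m : ℕ) {f : X → ℕ} (hf : Measurable f) {c : ℝ} (hc : 0 ≤ c) :
    ENNReal.ofReal (c ^ 2) * Measure.pi (fun _ : Fin m => D)
      {S | ∃ v, c ≤ |deviation D S ((f ⁻¹' {v}).indicator 1)|} ≤ m := by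
  have hE : ∀ v, MeasurableSet (f ⁻¹' {v}) := fun v => hf (measurableSet_singleton v)
  have hmeas : ∀ v, Measurable fun S : Fin m → X =>
      ENNReal.ofReal (deviation D S ((f ⁻¹' {v}).indicator 1) ^ 2) := fun v =>
    ((measurable_deviation D m (measurable_one.indicator (hE v))).pow_const 2).ennreal_ofReal
  -- One large deviation already makes the sum of squares over all cells large. Markov's inequality
  -- for this sum suffices, since its integral is at most `m` times the total mass of the cells.
  set F : (Fin m → X) → ℝ≥0∞ := fun S =>
    ∑' v, ENNReal.ofReal (deviation D S ((f ⁻¹' {v}).indicator 1) ^ 2) with hF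
  calc _ ≤ ENNReal.ofReal (c ^ 2) * Measure.pi (fun _ : Fin m => D)
          {S | ENNReal.ofReal (c ^ 2) ≤ F S} := by
        refine mul_le_mul_right (measure_mono ?_) _
        rintro S ⟨v, hv⟩
        refine le_trans (ENNReal.ofReal_le_ofReal ?_) (ENNReal.le_tsum v)
        rw [← sq_abs (deviation _ _ _)]
        exact pow_le_pow_left₀ hc hv 2
    _ ≤ ∫⁻ S, F S ∂(Measure.pi fun _ : Fin m => D) :=
        mul_meas_ge_le_lintegral (Measurable.tsum hmeas) _
    _ = ∑' v, ∫⁻ S, ENNReal.ofReal (deviation D S ((f ⁻¹' {v}).indicator 1) ^ 2)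
          ∂(Measure.pi fun _ : Fin m => D) := lintegral_tsum fun v => (hmeas v).aemeasurable
    _ ≤ ∑' v, m * D (f ⁻¹' {v}) :=
        ENNReal.tsum_le_tsum fun v => lintegral_deviation_sq_le D m (hE v)
    _ = m := by
        rw [ENNReal.tsum_mul_left, ← measure_iUnion
          (fun a b hab => Disjoint.preimage f (by simpa using hab)) hE, ← Set.preimage_iUnion,
          Set.iUnion_of_singleton, Set.preimage_univ, measure_univ, mul_one]

/-- The partitions of the labelled points by the label, by the block and the label, and into
points. -/
def cell : Fin 3 → ℕ × Bool → ℕ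
  | 0, p => p.2.toNat
  | 1, p => if InBlock p.1 then Nat.pair p.1.unpair.1 p.2.toNat + 1 else 0
  | 2, p => Nat.pair p.1 p.2.toNat

/-- The indicator function of a cell of one of the partitions. -/
noncomputable def cellInd (k : Fin 3) (v : ℕ) : ℕ × Bool → ℝ := (cell k ⁻¹' {v}).indicator 1

/-- The zero hypothesis errs exactly on label `1`; on the support of `hyp x` the two labels exchange
roles. The support is the block, corrected at `x`: `σ` is `-1` if `x` is removed and `1` if it is
added. -/
lemma loss_eq (x : ℕ) : ∃ σ : ℝ, |σ| ≤ 1 ∧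
    {p : ℕ × Bool | hyp x p.1 ≠ p.2}.indicator 1 = cellInd 0 1
      + (cellInd 1 (Nat.pair x.unpair.1 0 + 1) - cellInd 1 (Nat.pair x.unpair.1 1 + 1))
      + σ • (cellInd 2 (Nat.pair x 0) - cellInd 2 (Nat.pair x 1)) := by
  refine ⟨if InBlock x then -1 else 1, by split_ifs <;> simp, funext fun p => ?_⟩
  obtain ⟨y, b⟩ := p
  by_cases hyx : y = x
  · subst hyx
    by_cases hy : InBlock y <;> cases b <;> simp [cellInd, cell, Set.indicator, hyp, hy]
  · by_cases hx : InBlock x <;> by_cases hy : InBlock y <;>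
      by_cases hcol : y.unpair.1 = x.unpair.1 <;> cases b <;>
      simp [cellInd, cell, Set.indicator, hyp, hx, hy, hcol, hyx]

lemma errCount_ofFn {m : ℕ} (S : Fin m → ℕ × Bool) (x : ℕ) :
    (errCount (List.ofFn S) x : ℝ) =
      ∑ i, {p : ℕ × Bool | hyp x p.1 ≠ p.2}.indicator (1 : ℕ × Bool → ℝ) (S i) := by
  induction m with
  | zero => simp [errCount]
  | succ m ih =>
    have := ih fun i => S i.succ
    simp only [errCount, bne_iff_ne, List.ofFn_succ, List.countP_cons, Fin.sum_univ_succ] at this ⊢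
    push_cast
    rw [this, add_comm]
    simp [Set.indicator]

/-- The factor `5` counts the cell indicators in `loss_eq`. -/
lemma abs_errCount_sub_le {D : Measure (ℕ × Bool)} [IsProbabilityMeasure D] {m : ℕ}
    {S : Fin m → ℕ × Bool} {c : ℝ} (h : ∀ k v, |deviation D S (cellInd k v)| ≤ c) (x : ℕ) :
    |errCount (List.ofFn S) x - m * (genError D (hyp x)).toReal| ≤ 5 * c := by
  have hint : ∀ k v, Integrable (cellInd k v) D := fun k v =>
    (integrable_const (1 : ℝ)).indicator .of_discrete
  obtain ⟨σ, hσ, hloss⟩ := loss_eq x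
  have heq : errCount (List.ofFn S) x - m * (genError D (hyp x)).toReal =
      deviation D S ({p : ℕ × Bool | hyp x p.1 ≠ p.2}.indicator 1) := by
    rw [deviation, errCount_ofFn, integral_indicator_one .of_discrete]
    rfl
  set a₁ := Nat.pair x.unpair.1 0 + 1
  set a₂ := Nat.pair x.unpair.1 1 + 1
  set b₁ := Nat.pair x 0
  set b₂ := Nat.pair x 1
  have hdev : deviation D S ({p : ℕ × Bool | hyp x p.1 ≠ p.2}.indicator 1) =
      deviation D S (cellInd 0 1)
        + (deviation D S (cellInd 1 a₁) - deviation D S (cellInd 1 a₂))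
        + σ * (deviation D S (cellInd 2 b₁) - deviation D S (cellInd 2 b₂)) := by
    rw [hloss]
    simp only [deviation]
    rw [integral_add' ((hint _ _).add ((hint _ _).sub (hint _ _)))
        (((hint _ _).sub (hint _ _)).smul σ),
      integral_add' (hint _ _) ((hint _ _).sub (hint _ _)), integral_sub' (hint _ _) (hint _ _)]
    have : ∫ p, (σ • (cellInd 2 b₁ - cellInd 2 b₂)) p ∂D =
        σ * (∫ p, cellInd 2 b₁ p ∂D - ∫ p, cellInd 2 b₂ p ∂D) := by
      rw [← integral_sub (hint _ _) (hint _ _), ← integral_const_mul]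
      rfl
    rw [this]
    simp only [Pi.add_apply, Pi.sub_apply, Pi.smul_apply, smul_eq_mul, Finset.sum_add_distrib,
      Finset.sum_sub_distrib, ← Finset.mul_sum]
    ring
  rw [heq, hdev]
  have hσ' : |σ * (deviation D S (cellInd 2 b₁) - deviation D S (cellInd 2 b₂))| ≤
      |deviation D S (cellInd 2 b₁) - deviation D S (cellInd 2 b₂)| := by
    rw [abs_mul]
    exact mul_le_of_le_one_left (abs_nonneg _) hσ
  have h1 := abs_sub (deviation D S (cellInd 2 b₁)) (deviation D S (cellInd 2 b₂))
  have h2 := abs_sub (deviation D S (cellInd 1 a₁)) (deviation D S (cellInd 1 a₂))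
  have h3 := abs_add_three (deviation D S (cellInd 0 1))
    (deviation D S (cellInd 1 a₁) - deviation D S (cellInd 1 a₂))
    (σ * (deviation D S (cellInd 2 b₁) - deviation D S (cellInd 2 b₂)))
  linarith [h 0 1, h 1 a₁, h 1 a₂, h 2 b₁, h 2 b₂]

/-! ### The learner PAC learns the class. -/

lemma succeeds_boxLearner {n M m : ℕ} (hn : 1 ≤ n)
    (hM : ∀ S : Sample, M ≤ S.length → ∀ x, Valid x →
      2 * n * errCount S (bestIndex S) ≤ 2 * n * errCount S x + S.length)
    (hm : M ≤ m) (hm' : 1200 * n ^ 3 ≤ m) : Succeeds haltingClass boxLearner n m := by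
  intro D hD
  have hm0 : 0 < m := lt_of_lt_of_le (by positivity) hm'
  have hn' : (0 : ℝ) < n := by exact_mod_cast hn
  have hmR : (0 : ℝ) < m := by exact_mod_cast hm0
  set P := Measure.pi fun _ : Fin m => D with hP
  -- Passing to empirical errors costs `5 * c = m / (4 * n)` for each of two hypotheses, and inexact
  -- minimization costs `m / (2 * n)`: together `m / n`. Each partition fails with probability at
  -- most `m / c ^ 2 = 400 * n ^ 2 / m`, which is at most `1 / (3 * n)` for `m ≥ 1200 * n ^ 3`.
  set c : ℝ := m / (20 * n) with hc
  have hcpos : 0 < c := by positivity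
  set bad : Fin 3 → Set (Fin m → ℕ × Bool) := fun k =>
    {S | ∃ v, c ≤ |deviation D S (cellInd k v)|} with hbad
  have hbad_le : ∀ k, P (bad k) ≤ ENNReal.ofReal (1 / (3 * n)) := fun k => by
    have h1 := mul_measure_exists_le_deviation_le D m (measurable_of_countable (cell k)) hcpos.le
    have h2 : P (bad k) ≤ m / ENNReal.ofReal (c ^ 2) := by
      rw [ENNReal.le_div_iff_mul_le (Or.inl (by simp; positivity)) (Or.inl (by simp)), mul_comm]
      exact h1
    refine h2.trans ?_
    rw [← ENNReal.ofReal_natCast, ← ENNReal.ofReal_div_of_pos (by positivity)]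
    refine ENNReal.ofReal_le_ofReal ?_
    have h3 : (1200 * n ^ 3 : ℝ) ≤ m := by exact_mod_cast hm'
    rw [hc, div_pow, div_div_eq_mul_div, div_le_div_iff₀ (by positivity) (by positivity)]
    nlinarith [mul_le_mul_of_nonneg_left h3 hmR.le]
  have hbadsum : P (⋃ k, bad k) ≤ 1 / n := by
    refine (measure_iUnion_fintype_le _ _).trans
      ((Finset.sum_le_sum fun k _ => hbad_le k).trans (le_of_eq ?_))
    rw [Finset.sum_const, Finset.card_univ, Fintype.card_fin, nsmul_eq_mul, ← ENNReal.ofReal_natCast,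
      ← ENNReal.ofReal_mul (by positivity), ← ENNReal.ofReal_natCast n, ← ENNReal.ofReal_one,
      ← ENNReal.ofReal_div_of_pos hn']
    congr 1
    push_cast
    field_simp
  have hgood : (⋃ k, bad k)ᶜ ⊆ {S : Fin m → ℕ × Bool | genError D (boxLearner (List.ofFn S)) ≤
      (⨅ h ∈ haltingClass, genError D h) + 1 / (n : ℝ≥0∞)} := by
    intro S hS
    simp only [hbad, Set.mem_compl_iff, Set.mem_iUnion, Set.mem_ofPred_eq, not_exists, not_le] at hS
    rw [Set.mem_ofPred_eq, ← tsub_le_iff_right]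
    refine le_iInf₂ ?_
    rintro _ ⟨x, hx, rfl⟩
    rw [tsub_le_iff_right]
    have hb := abs_le.1 (abs_errCount_sub_le (fun k v => (hS k v).le) (bestIndex (List.ofFn S)))
    have hx' := abs_le.1 (abs_errCount_sub_le (fun k v => (hS k v).le) x)
    have hE : (2 * n * errCount (List.ofFn S) (bestIndex (List.ofFn S)) : ℝ) ≤
        2 * n * errCount (List.ofFn S) x + m := by
      have := hM (List.ofFn S) (by simpa using hm) x hx
      rw [List.length_ofFn] at this
      exact_mod_cast this
    have hcm : 20 * n * c = m := by
      rw [hc]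
      field_simp
    have hreal : (genError D (boxLearner (List.ofFn S))).toReal ≤
        (genError D (hyp x)).toReal + 1 / n := by
      change (genError D (hyp (bestIndex (List.ofFn S)))).toReal ≤ _
      set e := (genError D (hyp (bestIndex (List.ofFn S)))).toReal
      set e' := (genError D (hyp x)).toReal
      have h1 : 2 * n * (m * e) ≤ 2 * n * (m * e') + 2 * m := by
        nlinarith [mul_le_mul_of_nonneg_left hb.1 hn'.le, mul_le_mul_of_nonneg_left hx'.2 hn'.le]
      have h2 : e * n ≤ e' * n + 1 := by
        refine le_of_mul_le_mul_left ?_ (by positivity : (0 : ℝ) < 2 * m)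
        linarith
      have h3 : e' + 1 / n = (e' * n + 1) / n := by field_simp
      rw [h3, le_div_iff₀ hn']
      exact h2
    have hfin : ∀ h, genError D h ≠ ∞ := fun h => measure_ne_top D _
    rw [← ENNReal.ofReal_toReal (hfin (boxLearner (List.ofFn S))),
      ← ENNReal.ofReal_toReal (hfin (hyp x)), ← ENNReal.ofReal_natCast n, ← ENNReal.ofReal_one,
      ← ENNReal.ofReal_div_of_pos hn', ← ENNReal.ofReal_add ENNReal.toReal_nonneg (by positivity)]
    exact ENNReal.ofReal_le_ofReal hreal
  calc 1 - 1 / (n : ℝ≥0∞) ≤ 1 - P (⋃ k, bad k) := tsub_le_tsub_left hbadsum 1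
    _ = P (⋃ k, bad k)ᶜ := (prob_compl_eq_one_sub (Set.to_countable _).measurableSet).symm
    _ ≤ _ := measure_mono hgood

lemma pacLearns_boxLearner : PACLearns boxLearner haltingClass := by
  intro n hn
  obtain ⟨M, hM⟩ := exists_forall_errCount_bestIndex_le (2 * n)
  exact ⟨max M (1200 * n ^ 3), fun m hm => succeeds_boxLearner hn hM
    ((le_max_left _ _).trans hm) ((le_max_right _ _).trans hm)⟩

/-! ### Success on the uniform distribution of a block. -/

/-- A labelled point of the block of column `i`. -/
def blockPoint (i : ℕ) (j : Fin (i + 2)) : ℕ × Bool := (Nat.pair i j, true)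

/-- The uniform distribution on the points of a block, labelled by `true`. -/
noncomputable def blockMeasure (i : ℕ) : Measure (ℕ × Bool) :=
  (PMF.uniformOfFintype (Fin (i + 2))).toMeasure.map (blockPoint i)

instance (i : ℕ) : IsProbabilityMeasure (blockMeasure i) :=
  Measure.isProbabilityMeasure_map (measurable_of_countable _).aemeasurable

lemma ae_blockMeasure (i : ℕ) : ∀ᵐ p ∂blockMeasure i, ∃ j, p = blockPoint i j :=
  (ae_map_iff (measurable_of_countable _).aemeasurable (Set.to_countable _).measurableSet).2
    (ae_of_all _ fun j => ⟨j, rfl⟩)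

lemma le_blockMeasure_singleton (i : ℕ) (j : Fin (i + 2)) :
    ((i + 2 : ℕ) : ℝ≥0∞)⁻¹ ≤ blockMeasure i {blockPoint i j} := by
  rw [blockMeasure, Measure.map_apply (measurable_of_countable _) (measurableSet_singleton _)]
  calc ((i + 2 : ℕ) : ℝ≥0∞)⁻¹ = (PMF.uniformOfFintype (Fin (i + 2))).toMeasure {j} := by
        rw [PMF.toMeasure_apply_singleton _ _ (measurableSet_singleton _)]
        simp
    _ ≤ _ := measure_mono (by rintro _ rfl; rfl)

lemma genError_blockMeasure_eq_zero {i t : ℕ} (ht : i + 2 ≤ t) :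
    genError (blockMeasure i) (hyp (Nat.pair i t)) = 0 := by
  refine (measure_eq_zero_iff_ae_notMem).2 ((ae_blockMeasure i).mono ?_)
  rintro _ ⟨j, rfl⟩ h
  refine h ?_
  change hyp _ _ = true
  rw [hyp_eq_true_iff]
  intro hh
  have h1 := hh.1 ⟨by simp [blockPoint], by simp [blockPoint, InBlock]⟩
  simp only [blockPoint, Nat.pair_eq_pair, true_and] at h1
  omega

/-- If the program number `i` halts, then a learner that succeeds with accuracy better than
`1 / (i + 2)` outputs on some sample from the block a hypothesis that contains the block. -/
lemma Succeeds.exists_sample {A : Learner} {i m t : ℕ}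
    (hA : Succeeds haltingClass A (i + 3) m) (ht : HaltsBy i t) :
    ∃ f : Fin m → Fin (i + 2), ∀ j : Fin (i + 2),
      A (List.ofFn fun k => blockPoint i (f k)) (Nat.pair i j) = true := by
  have hpos : (1 - 1 / ((i + 3 : ℕ) : ℝ≥0∞)) ≠ 0 := by
    rw [ne_eq, tsub_eq_zero_iff_le, not_le, one_div, ENNReal.inv_lt_one]
    exact_mod_cast (by omega : 1 < i + 3)
  -- Only positive probability of success is needed: such an event meets the almost sure event that
  -- all draws come from the block.
  have hsucc := frequently_ae_mem_iff.2
    fun h0 => hpos (nonpos_iff_eq_zero.1 ((hA (blockMeasure i) inferInstance).trans h0.le))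
  have hae : ∀ᵐ S ∂(Measure.pi fun _ : Fin m => blockMeasure i), ∀ k, ∃ j, S k = blockPoint i j :=
    Filter.eventually_all.2 fun k =>
      (Measure.tendsto_eval_ae_ae (μ := fun _ : Fin m => blockMeasure i) (i := k)).eventually
        (ae_blockMeasure i)
  obtain ⟨S, hS, hblock⟩ := (hsucc.and_eventually hae).exists
  choose f hf using hblock
  obtain rfl : S = fun k => blockPoint i (f k) := funext hf
  refine ⟨f, fun j => ?_⟩
  -- The maximum keeps the halting witness and moves it out of the block, so the optimal error is
  -- `0`.
  set t' := max t (i + 2) with ht'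
  have hmem : hyp (Nat.pair i t') ∈ haltingClass :=
    ⟨_, Or.inr (by simpa using ht.mono (le_max_left _ _)), rfl⟩
  have herr : genError (blockMeasure i) (A (List.ofFn fun k => blockPoint i (f k))) ≤
      1 / ((i + 3 : ℕ) : ℝ≥0∞) := by
    refine (Set.mem_ofPred_eq ▸ hS).trans ?_
    rw [(nonpos_iff_eq_zero.1 ((iInf₂_le _ hmem).trans
      (genError_blockMeasure_eq_zero (le_max_right _ _)).le)), zero_add]
  by_contra hj
  -- A single missed block point would already cost `1 / (i + 2)`, more than the allowed `1 / (i +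
  -- 3)`.
  have h1 : ((i + 2 : ℕ) : ℝ≥0∞)⁻¹ ≤ 1 / ((i + 3 : ℕ) : ℝ≥0∞) := by
    refine ((le_blockMeasure_singleton i j).trans (measure_mono ?_)).trans herr
    rintro _ rfl
    exact hj
  rw [one_div, ENNReal.inv_le_inv, Nat.cast_le] at h1
  omega

/-- A hypothesis indexed by a block point misses that point, so the index must be a halting witness.
-/
lemma haltsBy_of_forall_hyp {x i : ℕ} (hx : Valid x)
    (h : ∀ j < i + 2, hyp x (Nat.pair i j) = true) : ∃ t, HaltsBy i t := by
  have hcol : i = x.unpair.1 := by simpa using col_eq_of_hyp (h 0 (by omega))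
  rcases hx with hx | hx
  · unfold InBlock at hx
    have h1 := h x.unpair.2 (by omega)
    rw [hcol, Nat.pair_unpair, hyp_eq_true_iff] at h1
    exact absurd ⟨fun _ => rfl, fun _ => ⟨rfl, hx⟩⟩ h1
  · exact ⟨_, hcol ▸ hx⟩

/-! ### Reduction of the halting problem to a computable sample bound. -/

/-- The sample of size `m` from the block of column `i` that is coded by `a` in base `i + 2`. -/
def blockSample (i m a : ℕ) : Sample :=
  (List.range m).map fun k => (Nat.pair i (a / (i + 2) ^ k % (i + 2)), true)

lemma exists_blockSample_eq (i : ℕ) {m : ℕ} (f : Fin m → Fin (i + 2)) :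
    ∃ a < (i + 2) ^ m, blockSample i m a = List.ofFn fun k => blockPoint i (f k) := by
  refine ⟨finFunctionFinEquiv f, (finFunctionFinEquiv f).2, ?_⟩
  have hf : ∀ k, (f k : ℕ) = (finFunctionFinEquiv f : ℕ) / (i + 2) ^ (k : ℕ) % (i + 2) := fun k =>
    congrArg (fun g => ((g k : Fin (i + 2)) : ℕ)) (finFunctionFinEquiv.symm_apply_apply f).symm
  refine List.ext_getElem (by simp [blockSample]) fun k h1 h2 => ?_
  simp only [blockSample, blockPoint, List.getElem_map, List.getElem_range, List.getElem_ofFn]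
  rw [hf]

lemma primrec_blockSample :
    Primrec fun q : (ℕ × ℕ) × ℕ => blockSample q.1.1 q.1.2 q.2 := by
  refine Primrec.list_map (Primrec.list_range.comp (Primrec.snd.comp .fst)) ?_
  have hi : Primrec fun r : ((ℕ × ℕ) × ℕ) × ℕ => r.1.1.1 :=
    Primrec.fst.comp (Primrec.fst.comp .fst)
  have hi2 := Primrec.nat_add.comp hi (Primrec.const 2)
  have hpow : Primrec₂ fun a b : ℕ => a ^ b := Primrec₂.unpaired'.1 Nat.Primrec.pow
  exact (Primrec₂.natPair.comp hi (Primrec.nat_mod.comp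
    (Primrec.nat_div.comp (Primrec.snd.comp .fst) (hpow.comp hi2 .snd)) hi2)).pair (.const true)

lemma computable_forall_lt {α : Type*} [Primcodable α] {p : α → ℕ → Bool} {b : α → ℕ}
    (hp : Computable₂ p) (hb : Computable b) :
    Computable fun a => decide (∀ j < b a, p a j = true) := by
  have h : Computable fun a => (b a).rec (motive := fun _ => Bool) true fun k r => r && p a k :=
    Computable.nat_rec hb (.const true) (Primrec.and.to_comp.comp
      (Computable.snd.comp .snd) (hp.comp .fst (Computable.fst.comp .snd))).to₂
  refine h.of_eq fun a => ?_
  induction b a with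
  | zero => simp
  | succ k ih =>
    simp only [ih]
    rw [Bool.eq_iff_iff]
    rw [Bool.and_eq_true, decide_eq_true_iff, decide_eq_true_iff, Nat.forall_lt_succ_right]

lemma computable_exists_lt {α : Type*} [Primcodable α] {p : α → ℕ → Bool} {b : α → ℕ}
    (hp : Computable₂ p) (hb : Computable b) :
    Computable fun a => decide (∃ j < b a, p a j = true) := by
  refine (Primrec.not.to_comp.comp
    (computable_forall_lt (Primrec.not.to_comp.comp₂ hp) hb)).of_eq fun a => ?_
  rw [Bool.eq_iff_iff]
  simp

lemma IsComputable.computable₂ {A : Learner} (hA : IsComputable A) : Computable₂ A := by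
  obtain ⟨c, hc, h⟩ := hA
  have h1 : Computable fun q : Sample × ℕ => (A q.1 q.2).toNat :=
    Partrec.of_eq_tot (Code.eval_part.comp (hc.comp .fst) .snd) fun q => by simp [h]
  exact (Primrec.beq.to_comp.comp h1 (.const 1)).of_eq fun q => by cases A q.1 q.2 <;> rfl

lemma not_computablePred_exists_haltsBy : ¬ ComputablePred fun i => ∃ t, HaltsBy i t := by
  intro h
  obtain ⟨f, hf, hfeq⟩ := ComputablePred.computable_iff.1 h
  refine ComputablePred.halting_problem 0 (ComputablePred.computable_iff.2
    ⟨fun c => f (Encodable.encode c), hf.comp .encode, funext fun c => ?_⟩)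
  rw [← congrFun hfeq, exists_haltsBy_iff, Denumerable.ofNat_encode]

theorem not_computably_bounded {A : Learner} (hA : IsComputable A)
    (hpac : PACLearns A haltingClass) (hproper : IsProper A haltingClass) :
    ¬ ∃ g : ℕ → ℕ, Computable g ∧ ∀ n : ℕ, 1 ≤ n → sampleComplexity haltingClass A n ≤ g n := by
  rintro ⟨g, hg, hle⟩
  -- PAC learning makes the set of thresholds nonempty, so its infimum is attained and is not the
  -- default `0`; hence `g n` itself is a sufficient sample size.
  have hsucc : ∀ n, 1 ≤ n → Succeeds haltingClass A n (g n) := fun n hn =>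
    Nat.sInf_mem (hpac n hn) (g n) (hle n hn)
  have hgi : Computable fun i => g (i + 3) :=
    hg.comp (Primrec.nat_add.comp .id (.const 3)).to_comp
  have hi2 : Primrec fun i : ℕ => i + 2 := Primrec.nat_add.comp .id (.const 2)
  have hpow : Primrec₂ fun a b : ℕ => a ^ b := Primrec₂.unpaired'.1 Nat.Primrec.pow
  have hsample : Computable fun q : ℕ × ℕ => blockSample q.1 (g (q.1 + 3)) q.2 :=
    primrec_blockSample.to_comp.comp (f := fun q : (ℕ × ℕ) × ℕ => blockSample q.1.1 q.1.2 q.2)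
      ((Computable.fst.pair (hgi.comp .fst)).pair .snd)
  have hpoint : Computable₂ fun (q : ℕ × ℕ) (j : ℕ) => Nat.pair q.1 j :=
    Primrec₂.natPair.to_comp.comp (Computable.fst.comp .fst) .snd
  have hvalue : Computable₂ fun (q : ℕ × ℕ) (j : ℕ) =>
      A (blockSample q.1 (g (q.1 + 3)) q.2) (Nat.pair q.1 j) :=
    hA.computable₂.comp (hsample.comp .fst) hpoint
  have hcontains : Computable₂ fun i a : ℕ => decide (∀ j < i + 2,
      A (blockSample i (g (i + 3)) a) (Nat.pair i j) = true) :=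
    computable_forall_lt hvalue (hi2.to_comp.comp .fst)
  have hdec := computable_exists_lt hcontains (hpow.to_comp.comp hi2.to_comp hgi)
  refine not_computablePred_exists_haltsBy (ComputablePred.computable_iff.2
    ⟨_, hdec, funext fun i => propext ?_⟩)
  simp only [decide_eq_true_eq]
  constructor
  · rintro ⟨t, ht⟩
    obtain ⟨f, hf⟩ := (hsucc (i + 3) (by omega)).exists_sample ht
    obtain ⟨a, ha, hS⟩ := exists_blockSample_eq i f
    exact ⟨a, ha, fun j hj => hS ▸ hf ⟨j, hj⟩⟩
  -- Properness alone gives this direction: any output containing the block certifies halting.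
  · rintro ⟨a, -, h⟩
    obtain ⟨x, hx, hxA⟩ := hproper (blockSample i (g (i + 3)) a)
    exact haltsBy_of_forall_hyp hx (by rwa [hxA])

end CPAC

theorem theorem3p8 :
    ∃ H : Set CPAC.Hypothesis,
      CPAC.FinitelySupported H ∧
      CPAC.IsDecidableClass H ∧
      CPAC.ProperlyCPACLearnable H ∧
      ¬ CPAC.ProperlySCPACLearnable H ∧
      ∀ A : CPAC.Learner, CPAC.IsComputable A → CPAC.PACLearns A H → CPAC.IsProper A H →
        ¬ ∃ g : ℕ → ℕ, Computable g ∧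
          ∀ n : ℕ, 1 ≤ n → CPAC.sampleComplexity H A n ≤ g n :=
  ⟨CPAC.haltingClass, CPAC.finitelySupported_haltingClass, CPAC.isDecidableClass_haltingClass,
    ⟨CPAC.boxLearner, CPAC.isComputable_boxLearner, CPAC.pacLearns_boxLearner,
      CPAC.isProper_boxLearner⟩,
    fun ⟨_, hA, hpac, hproper, hg⟩ => CPAC.not_computably_bounded hA hpac hproper hg,
    fun _ hA hpac hproper => CPAC.not_computably_bounded hA hpac hproper⟩
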